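/- All graphs are finite and simple. For a graph $G$, let $\chi(G)$ and $\omega(G)$ be its chromatic number and clique number, and say that $G$ is $H$-free if no induced subgraph of $G$ is isomorphic to $H$. For integers $s,w\ge 1$, let $R(s,w)$ be the least integer $n\ge 1$ such that every $n$-vertex graph has a stable set of size $s$ or a clique of size $w$. For integers $k\ge 2$ and $\ell\ge 1$, the $(k,\ell)$-broom is the graph obtained from the star $K_{1,\ell+1}$ by subdividing one edge exactly $k-2$ times; a broom is a graph isomorphic to the $(k,\ell)$-broom for some $k\ge 2$ and $\ell\ge 1$. Let $\overline{mK_s}$ be the complement of the disjoint union of $m$ copies of $K_s$, that is, the complete multipartite graph with $m$ parts of size $s$. **Theorem.** For every two integers $m\ge 1$ and $s\ge 2$, and every forest $T$ all of whose components are brooms, there exists an integer $C=C(m,s,T)\ge 1$ such that every graph $G$ that is both $T$-free and $\overline{mK_s}$-free satisfies $$\chi(G)\le C\cdot R(s,\omega(G)+1).$$ -/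

import Mathlib

universe u v

/-- The `(k, ℓ)`-broom: the star `K_{1,ℓ+1}` with one edge subdivided `k - 2` times (for `k ≥ 2`).
Its centre is `inl 0`; the subdivided edge is the path `inl 0, inl 1, …, inl (k - 1)` on `k` vertices,
and the other `ℓ` leaves of the star are the vertices `inr j`. -/
def broom (k ℓ : ℕ) : SimpleGraph (Fin k ⊕ Fin ℓ) where
  Adj
    | .inl i, .inl j => i.val + 1 = j.val ∨ j.val + 1 = i.val
    | .inl i, .inr _ => i.val = 0
    | .inr _, .inl i => i.val = 0
    | .inr _, .inr _ => False
  symm := ⟨by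
    rintro (i | i) (j | j) h
    · exact h.symm
    · exact h
    · exact h
    · exact h⟩
  loopless := ⟨by
    rintro (i | i) h
    · rcases h with h | h <;> omega
    · exact h⟩

/-- A graph is a broom if it is isomorphic to the `(k, ℓ)`-broom for some `k ≥ 2` and `ℓ ≥ 1`. -/
def IsBroom {V : Type*} (H : SimpleGraph V) : Prop :=
  ∃ k ℓ : ℕ, 2 ≤ k ∧ 1 ≤ ℓ ∧ Nonempty (H ≃g broom k ℓ)

/-- `m K_s`, the disjoint union of `m` copies of the complete graph on `s` vertices. -/
def disjointCliques (m s : ℕ) : SimpleGraph (Fin m × Fin s) where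
  Adj x y := x.1 = y.1 ∧ x.2 ≠ y.2
  symm := ⟨fun _ _ h => ⟨h.1.symm, h.2.symm⟩⟩
  loopless := ⟨fun _ h => h.2 rfl⟩

/-- `G` is `H`-free: no induced subgraph of `G` is isomorphic to `H`. -/
def IsInducedFree {W V : Type*} (H : SimpleGraph W) (G : SimpleGraph V) : Prop :=
  ¬ H.IsIndContained G

/-- The Ramsey number `R(s, w)`: the least `n ≥ 1` such that every graph on `n` vertices has a
stable set of size `s` or a clique of size `w`. -/
noncomputable def ramseyNumber (s w : ℕ) : ℕ :=
  sInf {n : ℕ | 1 ≤ n ∧ ∀ G : SimpleGraph (Fin n),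
    (∃ A : Finset (Fin n), G.IsNIndepSet s A) ∨ (∃ A : Finset (Fin n), G.IsNClique w A)}

/-!
The proof is an induction on `m` with the forest `T` fixed. The Ramsey number enters only through
the property that every set of `r = R(s, ω(G) + 1)` vertices contains a stable set of size `s`,
and a set counts as large if it is not `M * r`-colourable for a suitable constant `M`.

If `S` is a stable set of size `s`, an induced complete multipartite graph with `m` parts of size
`s` among the common neighbours of `S` would, together with `S`, give one with `m + 1` parts. By
induction the common neighbourhood of `S` is therefore `c * r`-colourable, with `c` depending only
on `m`, `s` and `T` (`IsLocallyTame`). This has two consequences. For each large set `X`, fewer than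
`r` vertices are adjacent to almost all of `X` (`IsLocallyTame.card_bad_lt`). And each stable set of
size `ℓ + s` has a subset of size `ℓ` anticomplete to a large part of `X`
(`IsLocallyTame.exists_subset_anticomplete`).

It suffices to find, in every large set, an induced broom anticomplete to a set that is still
large: the remaining components of `T` are then found there one by one
(`exists_components_embedding`). The broom is grown as an induced path whose current end has many
neighbours in a set `H` that is highly connected and has large chromatic number, the other path
vertices having none in `H`. To prolong it, pass to a highly connected large subset of the part of
`H` not adjacent to the end, delete the fewer than `r` vertices adjacent to almost all of that
subset, and walk there inside `H`, which remains connected after the deletion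
(`IsGrowingPath.exists_succ`). When the path is long enough, its end becomes the centre of the
broom, and the bristles are chosen among the neighbours of the centre in `H`.

The highly connected subsets come from the fact that, if every induced subgraph without a separation
of order at most `k` is `m`-colourable, then the whole graph is `(m + 16 * k)`-colourable
(`exists_noSeparation_of_not_colorableOn`). The loss being linear in `k` makes the final
bound linear in `r`. The proof extends a precolouring of a set `Z` to the uncoloured set `U`,
maintaining that the degrees of `Z` into `U`, truncated at `2 * k`, have sum at most `4 * k ^ 2`. At a
separation one side carries at most half of this weight, so the other side is coloured first and
the separator then joins the boundary of the lighter side. If no separation exists, the `m` colour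
classes are matched with colours by an averaging argument that leaves at most `k` conflicts, and the conflicting vertices
receive fresh colours.
-/

open Finset

/-! ### Colourable sets and separations -/

section

open scoped Classical

variable {V : Type*}

/-- `G.induce X` has a proper colouring with the colours `0, …, n - 1`. -/
def ColorableOn (G : SimpleGraph V) (X : Finset V) (n : ℕ) : Prop :=
  ∃ f : V → ℕ, (∀ x ∈ X, f x < n) ∧ ∀ x ∈ X, ∀ y ∈ X, G.Adj x y → f x ≠ f y

variable {G : SimpleGraph V}

theorem ColorableOn.mono {X Y : Finset V} {m n : ℕ} (h : ColorableOn G X m) (hY : Y ⊆ X)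
    (hmn : m ≤ n) : ColorableOn G Y n := by
  obtain ⟨f, h1, h2⟩ := h
  exact ⟨f, fun x hx => (h1 x (hY hx)).trans_le hmn, fun x hx y hy => h2 x (hY hx) y (hY hy)⟩

theorem ColorableOn.union {X Y : Finset V} {m n : ℕ} (hX : ColorableOn G X m)
    (hY : ColorableOn G Y n) : ColorableOn G (X ∪ Y) (m + n) := by
  obtain ⟨f, f1, f2⟩ := hX
  obtain ⟨g, g1, g2⟩ := hY
  refine ⟨fun v => if v ∈ X then f v else m + g v, ?_, ?_⟩
  · intro x hx
    by_cases h : x ∈ X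
    · have := f1 x h
      simp only [h, if_true]; omega
    · have := g1 x (by simpa [h] using hx)
      simp only [h, if_false]; omega
  · intro x hx y hy hxy
    by_cases h : x ∈ X <;> by_cases h' : y ∈ X <;> simp only [h, h', if_true, if_false]
    · exact f2 x h y h' hxy
    · have := f1 x h
      omega
    · have := f1 y h'
      omega
    · have := g2 x (by simpa [h] using hx) y (by simpa [h'] using hy) hxy
      omega

theorem colorableOn_card (X : Finset V) : ColorableOn G X #X := by
  induction X using Finset.induction_on with
  | empty => exact ⟨fun _ => 0, by simp, by simp⟩
  | insert a X ha ih =>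
    have h1 : ColorableOn G {a} 1 :=
      ⟨fun _ => 0, by simp, by simp⟩
    have := h1.union ih
    rw [card_insert_of_notMem ha, add_comm, insert_eq]
    exact this

theorem ColorableOn.biUnion {ι : Type*} {n : ℕ} {t : ι → Finset V} (I : Finset ι)
    (h : ∀ i ∈ I, ColorableOn G (t i) n) : ColorableOn G (I.biUnion t) (#I * n) := by
  induction I using Finset.induction_on with
  | empty => simpa using colorableOn_card (G := G) (∅ : Finset V)
  | insert a I ha ih =>
    rw [biUnion_insert, card_insert_of_notMem ha, add_mul, one_mul, add_comm]
    exact (h a (by simp)).union (ih fun i hi => h i (by simp [hi]))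

/-- The subgraph induced on `H` has no separation of order at most `k`: no set `K` of at most `k`
vertices separates a nonempty part `P` of `H` from a nonempty remainder. For `k = 0` this says
that the induced subgraph is connected or empty; complete graphs qualify for every `k`. -/
def NoSeparation (G : SimpleGraph V) (k : ℕ) (H : Finset V) : Prop :=
  ∀ P K : Finset V, P ⊆ H → Disjoint P K → #K ≤ k → P.Nonempty → (H \ (P ∪ K)).Nonempty →
    ∃ p ∈ P, ∃ q ∈ H \ (P ∪ K), G.Adj p q

theorem NoSeparation.sdiff {a b k : ℕ} {H B : Finset V} (h : NoSeparation G k H) (hB : #B ≤ b)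
    (hk : a + b ≤ k) : NoSeparation G a (H \ B) := by
  intro P K hP hPK hK hne hne'
  have hPB : Disjoint P B := disjoint_left.2 fun x hx hxB => (mem_sdiff.1 (hP hx)).2 hxB
  have e : H \ (P ∪ (K ∪ B)) = (H \ B) \ (P ∪ K) := by
    ext x; simp only [mem_sdiff, mem_union]; tauto
  have := h P (K ∪ B) (hP.trans sdiff_subset) (disjoint_union_right.2 ⟨hPK, hPB⟩)
    ((card_union_le _ _).trans (by omega)) hne (by rwa [e])
  rwa [e] at this

theorem NoSeparation.mono {a k : ℕ} {H : Finset V} (h : NoSeparation G k H) (hk : a ≤ k) :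
    NoSeparation G a H := by
  simpa using h.sdiff (B := ∅) (b := 0) (by simp) (by simpa using hk)

theorem NoSeparation.lt_degree {k : ℕ} {H : Finset V} (h : NoSeparation G k H)
    (hH : ¬ ColorableOn G H (k + 1)) {x : V} (hx : x ∈ H) : k < #{y ∈ H | G.Adj x y} := by
  by_contra! hd
  by_cases hne : (H \ ({x} ∪ {y ∈ H | G.Adj x y})).Nonempty
  · obtain ⟨p, hp, q, hq, hpq⟩ := h {x} {y ∈ H | G.Adj x y} (by simpa using hx) (by simp) hd
      (by simp) hne
    rw [mem_singleton] at hp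
    subst hp
    simp only [mem_sdiff, mem_union, mem_filter] at hq
    exact hq.2 (Or.inr ⟨hq.1, hpq⟩)
  · rw [not_nonempty_iff_eq_empty, sdiff_eq_empty_iff_subset] at hne
    refine hH ((colorableOn_card H).mono le_rfl ?_)
    have := (card_le_card hne).trans (card_union_le _ _)
    simp only [card_singleton] at this
    omega

theorem NoSeparation.insert {H : Finset V} (h : NoSeparation G 0 H) {p q : V} (hp : p ∈ H)
    (hpq : G.Adj p q) : NoSeparation G 0 (insert q H) := by
  by_cases hqH : q ∈ H
  · rwa [insert_eq_of_mem hqH]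
  intro P K hP _ hK hne hne'
  obtain rfl : K = ∅ := by simpa using hK
  simp only [union_empty] at hne' ⊢
  by_cases h1 : (P ∩ H).Nonempty
  · by_cases h2 : (H \ (P ∩ H)).Nonempty
    · obtain ⟨x, hx, y, hy, hxy⟩ := h (P ∩ H) ∅ inter_subset_right (by simp) (by simp) h1
        (by simpa using h2)
      simp only [mem_inter, union_empty, mem_sdiff] at hx hy
      exact ⟨x, hx.1, y, by simp only [mem_sdiff, mem_insert]; tauto, hxy⟩
    · have hHP : ∀ x ∈ H, x ∈ P := by
        intro x hx
        by_contra hxP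
        exact h2 ⟨x, by simp [hx, hxP]⟩
      obtain ⟨y, hy⟩ := hne'
      simp only [mem_sdiff, mem_insert] at hy
      obtain rfl : y = q := by
        rcases hy.1 with h | h
        · exact h
        · exact absurd (hHP y h) hy.2
      exact ⟨p, hHP p hp, y, by simp [hy.2], hpq⟩
  · have hPH : ∀ x ∈ P, x ∉ H := fun x hx hxH => h1 ⟨x, by simp [hx, hxH]⟩
    obtain ⟨x, hx⟩ := hne
    obtain rfl : x = q := by
      rcases mem_insert.1 (hP hx) with h | h
      · exact h
      · exact absurd h (hPH x hx)
    refine ⟨x, hx, p, ?_, hpq.symm⟩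
    simp only [mem_sdiff, mem_insert]
    exact ⟨Or.inr hp, fun hpP => hPH p hpP hp⟩

end

/-! ### Extending colourings greedily and by averaging -/

section

open scoped Classical

variable {V : Type*} {G : SimpleGraph V}

/-- The number of neighbours of `v` in `X`. -/
noncomputable def degIn (G : SimpleGraph V) (X : Finset V) (v : V) : ℕ :=
  #{x ∈ X | G.Adj v x}

theorem degIn_mono {X Y : Finset V} (h : X ⊆ Y) (v : V) : degIn G X v ≤ degIn G Y v :=
  card_le_card (filter_subset_filter _ h)

theorem degIn_union_le (X Y : Finset V) (v : V) :
    degIn G (X ∪ Y) v ≤ degIn G X v + degIn G Y v := by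
  unfold degIn
  rw [filter_union]
  exact card_union_le _ _

theorem degIn_le_card (X : Finset V) (v : V) : degIn G X v ≤ #X :=
  card_le_card (filter_subset _ _)

theorem sum_degIn_comm (X Y : Finset V) : ∑ x ∈ X, degIn G Y x = ∑ y ∈ Y, degIn G X y := by
  unfold degIn
  simp only [card_filter]
  rw [sum_comm]
  simp only [G.adj_comm]

/-- The colouring `col` of the vertices in `Z` extends to the vertices of `U`, with colours
below `N`, so that no edge between `U` and `U ∪ Z` is monochromatic. Edges inside `Z` are
disregarded, and the colours on `Z` need not be below `N`. -/
def ColoringExtends (G : SimpleGraph V) (N : ℕ) (U Z : Finset V) (col : V → ℕ) : Prop :=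
  ∃ col' : V → ℕ, (∀ v, v ∉ U → col' v = col v) ∧ (∀ u ∈ U, col' u < N) ∧
    ∀ u ∈ U, ∀ v ∈ U ∪ Z, G.Adj u v → col' u ≠ col' v

theorem ColoringExtends.of_erase {N a : ℕ} {U Z : Finset V} {col : V → ℕ} {u : V} (hu : u ∈ U)
    (ha : a < N) (hcol : ∀ z ∈ Z, G.Adj u z → col z ≠ a)
    (h : ColoringExtends G N (U.erase u) (insert u Z) (Function.update col u a)) :
    ColoringExtends G N U Z col := by
  obtain ⟨col', h1, h2, h3⟩ := h
  have hua : col' u = a := by rw [h1 u (by simp)]; simp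
  refine ⟨col', ?_, ?_, ?_⟩
  · intro v hv
    have hvu : v ≠ u := by rintro rfl; exact hv hu
    rw [h1 v (by simp [hv])]
    simp [hvu]
  · intro v hv
    by_cases hvu : v = u
    · rw [hvu, hua]; exact ha
    · exact h2 v (by simp [hv, hvu])
  · intro x hx y hy hxy
    by_cases hxu : x = u
    · subst hxu
      by_cases hyU : y ∈ U
      · exact (h3 y (by simp [hyU, hxy.ne']) x (by simp) hxy.symm).symm
      · have hyZ : y ∈ Z := by simpa [hyU] using hy
        have : col' y = col y := by
          rw [h1 y (by simp [hyU])]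
          simp [hxy.ne']
        rw [hua, this]
        exact (hcol y hyZ hxy).symm
    · refine h3 x (by simp [hx, hxu]) y ?_ hxy
      simp only [mem_union, mem_erase, mem_insert] at hy ⊢
      tauto

theorem add_mod_inj {n t a b : ℕ} (ha : a < n) (hb : b < n) (h : (a + t) % n = (b + t) % n) :
    a = b := by
  have : a ≡ b [MOD n] := Nat.ModEq.add_right_cancel' t h
  rwa [Nat.ModEq, Nat.mod_eq_of_lt ha, Nat.mod_eq_of_lt hb] at this

/-- Averaging over the cyclic shifts of a palette: if few colours are forbidden in total, some
shift gives a forbidden colour to at most `k` vertices. -/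
theorem exists_shift_few_conflicts {n k : ℕ} (hn : 0 < n) (U : Finset V) (f : V → ℕ)
    (F : V → Finset ℕ) (g : ℕ → ℕ) (hg : Set.InjOn g (Set.Iio n)) (hF : ∑ u ∈ U, #(F u) ≤ k * n) :
    ∃ t, #{u ∈ U | g ((f u + t) % n) ∈ F u} ≤ k := by
  by_contra! hcon
  have h1 : n * (k + 1) ≤ ∑ t ∈ range n, #{u ∈ U | g ((f u + t) % n) ∈ F u} := by
    have := card_nsmul_le_sum (range n) (fun t => #{u ∈ U | g ((f u + t) % n) ∈ F u}) (k + 1)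
      (fun t _ => hcon t)
    simpa using this
  have h2 : ∑ t ∈ range n, #{u ∈ U | g ((f u + t) % n) ∈ F u} ≤ ∑ u ∈ U, #(F u) := by
    simp only [card_filter]
    rw [sum_comm]
    refine sum_le_sum fun u _ => ?_
    rw [← card_filter]
    refine card_le_card_of_injOn (fun t => g ((f u + t) % n)) (fun t ht => ?_) ?_
    · simp only [coe_filter, Set.mem_ofPred_eq] at ht
      exact ht.2
    · intro t ht t' ht' e
      simp only [coe_filter, mem_range, Set.mem_ofPred_eq] at ht ht'
      have e' := hg (Set.mem_Iio.2 (Nat.mod_lt _ hn)) (Set.mem_Iio.2 (Nat.mod_lt _ hn)) e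
      rw [add_comm, add_comm (f u)] at e'
      exact add_mod_inj ht.1 ht'.1 e'
  nlinarith

/-- Greedy choice of distinct colours avoiding small lists of forbidden ones. -/
theorem exists_injOn_avoiding (a b : ℕ) (F : V → Finset ℕ) (S : Finset V)
    (hF : ∀ u ∈ S, #(F u) ≤ a) :
    ∃ e : V → ℕ, Set.InjOn e S ∧ ∀ u ∈ S, b ≤ e u ∧ e u < b + a + #S ∧ e u ∉ F u := by
  induction S using Finset.induction_on with
  | empty => exact ⟨fun _ => 0, by simp, by simp⟩
  | insert x S hx ih =>
    obtain ⟨e, he, h⟩ := ih fun u hu => hF u (by simp [hu])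
    have hne : (Ico b (b + a + #(insert x S)) \ (F x ∪ S.image e)).Nonempty := by
      rw [← card_pos]
      have h1 := le_card_sdiff (F x ∪ S.image e) (Ico b (b + a + #(insert x S)))
      have h2 := card_union_le (F x) (S.image e)
      have h3 := hF x (by simp)
      have h4 : #(S.image e) ≤ #S := card_image_le
      rw [card_insert_of_notMem hx, Nat.card_Ico] at h1
      rw [card_insert_of_notMem hx]
      omega
    obtain ⟨c, hc⟩ := hne
    simp only [mem_sdiff, mem_Ico, mem_union, mem_image, not_or, not_exists, not_and] at hc
    obtain ⟨⟨hc1, hc2⟩, hc3, hc4⟩ := hc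
    have hup : ∀ u ∈ S, Function.update e x c u = e u := fun u hu =>
      Function.update_of_ne (by rintro rfl; exact hx hu) _ _
    refine ⟨Function.update e x c, ?_, ?_⟩
    · rw [coe_insert, Set.injOn_insert (by simpa using hx)]
      refine ⟨fun u hu v hv huv => ?_, ?_⟩
      · rw [hup u hu, hup v hv] at huv
        exact he hu hv huv
      · rintro ⟨u, hu, huv⟩
        rw [hup u hu, Function.update_self] at huv
        exact hc4 u hu huv
    · intro u hu
      rcases mem_insert.1 hu with rfl | hu
      · rw [Function.update_self]
        exact ⟨hc1, hc2, hc3⟩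
      · rw [hup u hu, card_insert_of_notMem hx]
        have := h u hu
        exact ⟨this.1, by omega, this.2.2⟩

/-- An `m`-colourable set `U` can be coloured compatibly with a precoloured set `hi ∪ lo` when
`hi` is small and `lo` sends few edges to `U`: give the colour classes colours not used on `hi`,
shifted so that at most `k` vertices conflict with `lo`, and recolour those vertices with fresh
colours. -/
theorem coloringExtends_of_colorableOn {m k : ℕ} (hk : 1 ≤ k) {U lo hi : Finset V}
    {col : V → ℕ} (hU : ColorableOn G U m) (hhi : #hi ≤ 2 * k)
    (hlo : ∑ u ∈ U, degIn G lo u ≤ 4 * k ^ 2) (hdeg : ∀ u ∈ U, degIn G (lo ∪ hi) u ≤ 9 * k) :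
    ColoringExtends G (m + 16 * k) U (lo ∪ hi) col := by
  obtain ⟨f, hf1, hf2⟩ := hU
  -- the palette: `m + 4 * k` colours for the classes, room for `2 * k` colours used on `hi`, and
  -- `9 * k + k` fresh colours for the conflicting vertices
  obtain ⟨A, hA, hAc⟩ : ∃ A ⊆ range (m + 4 * k + 2 * k) \ hi.image col, #A = m + 4 * k := by
    refine exists_subset_card_eq ?_
    have h1 := le_card_sdiff (hi.image col) (range (m + 4 * k + 2 * k))
    have h2 : #(hi.image col) ≤ #hi := card_image_le
    rw [card_range] at h1
    omega
  obtain ⟨g, hgA, hginj⟩ : ∃ g : ℕ → ℕ, (∀ i < m + 4 * k, g i ∈ A) ∧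
      Set.InjOn g (Set.Iio (m + 4 * k)) := by
    refine ⟨fun i => if h : i < m + 4 * k then A.orderEmbOfFin hAc ⟨i, h⟩ else 0, ?_, ?_⟩
    · intro i hi
      simp only [hi, dif_pos]
      exact orderEmbOfFin_mem _ _ _
    · intro i hi j hj hij
      rw [Set.mem_Iio] at hi hj
      simp only [hi, hj, dif_pos] at hij
      simpa using (A.orderEmbOfFin hAc).injective hij
  have hpos : 0 < m + 4 * k := by omega
  obtain ⟨t, ht⟩ := exists_shift_few_conflicts (k := k) hpos U f
    (fun u => {z ∈ lo | G.Adj u z}.image col) g hginj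
    ((sum_le_sum fun u _ => card_image_le).trans (hlo.trans (by nlinarith)))
  set W := {u ∈ U | g ((f u + t) % (m + 4 * k)) ∈ {z ∈ lo | G.Adj u z}.image col} with hW
  obtain ⟨e, he1, he2⟩ := exists_injOn_avoiding (9 * k) (m + 4 * k + 2 * k)
    (fun u => {z ∈ lo ∪ hi | G.Adj u z}.image col) W
    (fun u hu => card_image_le.trans (hdeg u (mem_filter.1 hu).1))
  have hgm : ∀ u, g ((f u + t) % (m + 4 * k)) ∈ A := fun u => hgA _ (Nat.mod_lt _ hpos)
  have hglt : ∀ u, g ((f u + t) % (m + 4 * k)) < m + 4 * k + 2 * k := fun u => by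
    have := hA (hgm u)
    simp only [mem_sdiff, mem_range] at this
    exact this.1
  have hWU : ∀ u ∈ W, u ∈ U := fun u hu => (mem_filter.1 hu).1
  refine ⟨fun v => if v ∈ W then e v else if v ∈ U then g ((f v + t) % (m + 4 * k)) else col v,
    ?_, ?_, ?_⟩
  · intro v hv
    have : v ∉ W := fun h => hv (hWU v h)
    simp [this, hv]
  · intro u hu
    by_cases huW : u ∈ W
    · have := he2 u huW
      simp only [huW, if_true]
      omega
    · have := hglt u
      simp only [huW, hu, if_true, if_false]
      omega
  · intro u hu v hv huv
    by_cases hvU : v ∈ U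
    · by_cases huW : u ∈ W <;> by_cases hvW : v ∈ W <;>
        simp only [huW, hvW, hu, hvU, if_true, if_false]
      · exact fun h => huv.ne (he1 huW hvW h)
      · have := he2 u huW
        have := hglt v
        omega
      · have := he2 v hvW
        have := hglt u
        omega
      · intro h
        have h' := hginj (Set.mem_Iio.2 (Nat.mod_lt _ hpos)) (Set.mem_Iio.2 (Nat.mod_lt _ hpos)) h
        have h1 := hf1 u hu
        have h2 := hf1 v hvU
        exact hf2 u hu v hvU huv (add_mod_inj (by omega) (by omega) h')
    · have hvZ : v ∈ lo ∪ hi := by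
        rcases mem_union.1 hv with h | h
        · exact absurd h hvU
        · exact h
      have hvW : v ∉ W := fun h => hvU (hWU v h)
      by_cases huW : u ∈ W <;> simp only [huW, hvW, hu, hvU, if_true, if_false]
      · intro h
        exact (he2 u huW).2.2 (mem_image.2 ⟨v, by simp only [mem_filter]; exact ⟨hvZ, huv⟩, h.symm⟩)
      · intro h
        rcases mem_union.1 hvZ with hvl | hvh
        · refine huW (mem_filter.2 ⟨hu, mem_image.2 ⟨v, ?_, h.symm⟩⟩)
          simp only [mem_filter]
          exact ⟨hvl, huv⟩
        · have := hA (hgm u)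
          rw [mem_sdiff] at this
          exact this.2 (mem_image.2 ⟨v, hvh, h.symm⟩)

end

/-! ### Highly connected subsets of large chromatic number -/

section

open scoped Classical

variable {V : Type*} {G : SimpleGraph V}

/-- The weight of a precoloured set `Z` relative to the set `U` still to be coloured: each vertex
counts with its degree into `U`, truncated at `2 * k`. -/
noncomputable def boundaryWeight (G : SimpleGraph V) (k : ℕ) (U Z : Finset V) : ℕ :=
  ∑ z ∈ Z, min (2 * k) (degIn G U z)

/-- The bounds on a precoloured set `Z` that are kept while the uncoloured set `U` is cut along
separations. Together with the weight, `degIn_le` bounds by `9 * k` the number of precoloured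
neighbours of a vertex of `U`, and the weight term leaves room for vertices moved from `U` to `Z`. -/
structure IsLightBoundary (G : SimpleGraph V) (k : ℕ) (U Z : Finset V) : Prop where
  disjoint : Disjoint U Z
  weight_le : boundaryWeight G k U Z ≤ 4 * k ^ 2
  degIn_le : ∀ u ∈ U, 2 * k * degIn G Z u + boundaryWeight G k U Z ≤ 18 * k ^ 2

theorem boundaryWeight_mono {k : ℕ} {U U' Z : Finset V} (h : U' ⊆ U) :
    boundaryWeight G k U' Z ≤ boundaryWeight G k U Z :=
  sum_le_sum fun z _ => min_le_min le_rfl (degIn_mono h z)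

theorem IsLightBoundary.mono {k : ℕ} {U U' Z : Finset V} (h : IsLightBoundary G k U Z)
    (hU : U' ⊆ U) : IsLightBoundary G k U' Z where
  disjoint := disjoint_of_subset_left hU h.disjoint
  weight_le := (boundaryWeight_mono hU).trans h.weight_le
  degIn_le u hu := (Nat.add_le_add_left (boundaryWeight_mono hU) _).trans (h.degIn_le u (hU hu))

/-- The vertices of `Z` with fewer than `2 * k` neighbours in `U`. -/
noncomputable def lowPart (G : SimpleGraph V) (k : ℕ) (U Z : Finset V) : Finset V :=
  {z ∈ Z | degIn G U z < 2 * k}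

/-- The vertices of `Z` with at least `2 * k` neighbours in `U`. -/
noncomputable def highPart (G : SimpleGraph V) (k : ℕ) (U Z : Finset V) : Finset V :=
  {z ∈ Z | ¬ degIn G U z < 2 * k}

theorem lowPart_union_highPart (k : ℕ) (U Z : Finset V) :
    lowPart G k U Z ∪ highPart G k U Z = Z :=
  filter_union_filter_not_eq _ _

theorem lowPart_subset (k : ℕ) (U Z : Finset V) : lowPart G k U Z ⊆ Z := filter_subset _ _

theorem highPart_subset (k : ℕ) (U Z : Finset V) : highPart G k U Z ⊆ Z := filter_subset _ _

theorem boundaryWeight_eq (k : ℕ) (U Z : Finset V) :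
    boundaryWeight G k U Z =
      ∑ z ∈ lowPart G k U Z, degIn G U z + 2 * k * #(highPart G k U Z) := by
  unfold boundaryWeight
  rw [← sum_filter_add_sum_filter_not Z (fun z => degIn G U z < 2 * k)]
  congr 1
  · exact sum_congr rfl fun z hz => min_eq_right (mem_filter.1 hz).2.le
  · refine (sum_congr rfl fun z hz => min_eq_left (not_lt.1 (mem_filter.1 hz).2)).trans ?_
    rw [sum_const, smul_eq_mul, mul_comm]
    rfl

theorem degIn_erase_add {U : Finset V} {u z : V} (hu : u ∈ U) (hz : G.Adj z u) :
    degIn G (U.erase u) z + 1 = degIn G U z := by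
  have e : {x ∈ U.erase u | G.Adj z x} = {x ∈ U | G.Adj z x}.erase u := by
    ext x; simp only [mem_filter, mem_erase]; tauto
  unfold degIn
  rw [e, card_erase_add_one (by simp [hu, hz])]

/-- Moving a vertex with `4 * k` low-degree precoloured neighbours to the precoloured side lowers
the weight by `2 * k`. -/
theorem boundaryWeight_erase_insert {k : ℕ} {U Z : Finset V} {u : V} (hu : u ∈ U)
    (hZ : u ∉ Z) (hlow : 4 * k ≤ degIn G (lowPart G k U Z) u) :
    boundaryWeight G k (U.erase u) (insert u Z) + 2 * k ≤ boundaryWeight G k U Z := by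
  have h1 : ∑ z ∈ Z, (min (2 * k) (degIn G (U.erase u) z) +
      if z ∈ lowPart G k U Z ∧ G.Adj u z then 1 else 0) ≤ boundaryWeight G k U Z := by
    refine sum_le_sum fun z hz => ?_
    split_ifs with h
    · have h2 := degIn_erase_add hu h.2.symm
      have h3 : degIn G U z < 2 * k := (mem_filter.1 h.1).2
      rw [min_eq_right (by omega), min_eq_right (by omega)]
      omega
    · exact min_le_min le_rfl (degIn_mono (erase_subset _ _) z)
  rw [sum_add_distrib, ← card_filter] at h1
  have h2 : degIn G (lowPart G k U Z) u = #{z ∈ Z | z ∈ lowPart G k U Z ∧ G.Adj u z} := by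
    unfold degIn
    congr 1
    ext z
    simp only [mem_filter, lowPart]
    tauto
  unfold boundaryWeight at h1 ⊢
  rw [sum_insert hZ]
  have := min_le_left (2 * k) (degIn G (U.erase u) u)
  omega

theorem IsLightBoundary.erase_insert {k : ℕ} (hk : 1 ≤ k) {U Z : Finset V} {u : V}
    (h : IsLightBoundary G k U Z) (hu : u ∈ U) (hlow : 4 * k ≤ degIn G (lowPart G k U Z) u) :
    IsLightBoundary G k (U.erase u) (insert u Z) := by
  have huZ := disjoint_left.1 h.disjoint hu
  have hw := boundaryWeight_erase_insert hu huZ hlow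
  refine ⟨?_, by have := h.weight_le; omega, ?_⟩
  · rw [disjoint_left]
    intro x hx
    have hx' := mem_erase.1 hx
    simp only [mem_insert, not_or]
    exact ⟨hx'.1, disjoint_left.1 h.disjoint hx'.2⟩
  · intro x hx
    have h1 := h.degIn_le x (mem_of_mem_erase hx)
    have h2 : degIn G (insert u Z) x ≤ degIn G Z x + 1 := by
      rw [insert_eq, add_comm]
      exact (degIn_union_le _ _ _).trans (Nat.add_le_add_right (degIn_le_card {u} x) _)
    nlinarith

/-- Cutting along a separation: the heavier side (with the separator) is coloured first, then the
lighter side `P`, for which the separator has become part of the boundary. -/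
theorem coloringExtends_of_separation {N k : ℕ} {U Z P K Q : Finset V} {col : V → ℕ}
    (h : IsLightBoundary G k U Z) (hlow : ∀ u ∈ U, degIn G (lowPart G k U Z) u < 4 * k)
    (hcov : U ∪ highPart G k U Z ⊆ P ∪ K ∪ Q) (hKU : K ⊆ U ∪ Z)
    (hK : #K ≤ k) (hPK : Disjoint P K) (hPQ : Disjoint P Q)
    (hadj : ∀ p ∈ P, ∀ q ∈ Q, ¬ G.Adj p q) (hP : (U ∩ P).Nonempty) (hQ : (U ∩ Q).Nonempty)
    (hweight : 2 * k * #(highPart G k U Z ∩ P) + ∑ z ∈ lowPart G k U Z, degIn G (U ∩ P) z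
      ≤ 2 * k ^ 2)
    (ih : ∀ U' Z' col', #U' < #U → U' ⊆ U → Z' ⊆ U ∪ Z → IsLightBoundary G k U' Z' →
      ColoringExtends G N U' Z' col') :
    ColoringExtends G N U Z col := by
  set lo := lowPart G k U Z with hlo
  set hi := highPart G k U Z with hhi
  have hloZ : lo ⊆ Z := lowPart_subset _ _ _
  have hhiZ : hi ⊆ Z := highPart_subset _ _ _
  have hZ : lo ∪ hi = Z := lowPart_union_highPart _ _ _
  have hW := boundaryWeight_eq (G := G) k U Z
  rw [← hlo, ← hhi] at hW
  have hhik : 2 * k * #hi ≤ 4 * k ^ 2 := by have := h.weight_le; omega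
  obtain ⟨col₁, a1, a2, a3⟩ := ih (U \ P) Z col
    (by
      obtain ⟨x, hx⟩ := hP
      rw [mem_inter] at hx
      exact card_lt_card ⟨sdiff_subset, fun hs => (mem_sdiff.1 (hs hx.1)).2 hx.2⟩)
    sdiff_subset subset_union_right (h.mono sdiff_subset)
  set Z₂ := lo ∪ (hi ∩ P) ∪ K with hZ₂
  have hw2 : boundaryWeight G k (U ∩ P) Z₂ ≤ 2 * k ^ 2 + 2 * k * #K := by
    have b1 : boundaryWeight G k (U ∩ P) lo ≤ ∑ z ∈ lo, degIn G (U ∩ P) z :=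
      sum_le_sum fun z _ => min_le_right _ _
    have b2 : ∀ X, boundaryWeight G k (U ∩ P) X ≤ 2 * k * #X := fun X => by
      refine (sum_le_sum fun z _ => min_le_left _ _).trans (le_of_eq ?_)
      rw [sum_const, smul_eq_mul, mul_comm]
    have b3 : ∀ X Y, boundaryWeight G k (U ∩ P) (X ∪ Y) ≤
        boundaryWeight G k (U ∩ P) X + boundaryWeight G k (U ∩ P) Y := fun X Y => by
      unfold boundaryWeight
      rw [← sum_union_inter]
      exact Nat.le_add_right _ _
    have b4 := b3 (lo ∪ (hi ∩ P)) K
    have b5 := b3 lo (hi ∩ P)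
    have b6 := b2 (hi ∩ P)
    have b7 := b2 K
    rw [← hZ₂] at b4
    omega
  have hkK : 2 * k * #K ≤ 2 * k ^ 2 := by nlinarith
  have hlight : IsLightBoundary G k (U ∩ P) Z₂ := by
    refine ⟨?_, by omega, ?_⟩
    · rw [disjoint_left]
      intro x hx hxZ
      rw [mem_inter] at hx
      have hxZ' := disjoint_left.1 h.disjoint hx.1
      simp only [hZ₂, mem_union, mem_inter] at hxZ
      rcases hxZ with (h1 | h1) | h1
      · exact hxZ' (hloZ h1)
      · exact hxZ' (hhiZ h1.1)
      · exact disjoint_left.1 hPK hx.2 h1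
    · intro u hu
      have c1 := degIn_union_le (G := G) (lo ∪ (hi ∩ P)) K u
      have c2 := degIn_union_le (G := G) lo (hi ∩ P) u
      have c3 := hlow u (mem_inter.1 hu).1
      have c4 := degIn_le_card (G := G) (hi ∩ P) u
      have c5 : #(hi ∩ P) ≤ #hi := card_le_card inter_subset_left
      have c6 := degIn_le_card (G := G) K u
      have c7 : degIn G Z₂ u ≤ 4 * k + #hi + k := by
        rw [← hZ₂] at c1
        omega
      have c8 : 2 * k * degIn G Z₂ u ≤ 2 * k * (4 * k + #hi + k) := Nat.mul_le_mul_left _ c7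
      nlinarith
  have hZ₂U : Z₂ ⊆ U ∪ Z := by
    refine union_subset (union_subset ?_ ?_) hKU
    · exact hloZ.trans subset_union_right
    · exact (inter_subset_left.trans hhiZ).trans subset_union_right
  obtain ⟨col₂, b1, b2, b3⟩ := ih (U ∩ P) Z₂ col₁
    (by
      obtain ⟨x, hx⟩ := hQ
      rw [mem_inter] at hx
      exact card_lt_card ⟨inter_subset_left, fun hs =>
        disjoint_left.1 hPQ (mem_inter.1 (hs hx.1)).2 hx.2⟩)
    inter_subset_left hZ₂U hlight
  -- every coloured neighbour of a vertex of `P` lies in `Z₂`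
  have key : ∀ u ∈ U ∩ P, ∀ v ∈ U ∪ Z, G.Adj u v → col₂ u ≠ col₂ v := by
    intro u hu v hv huv
    refine b3 u hu v ?_ huv
    have hq : v ∉ Q := fun hq => hadj u (mem_inter.1 hu).2 v hq huv
    by_cases hvlo : v ∈ lo
    · exact mem_union_right _ (mem_union_left _ (mem_union_left _ hvlo))
    have hv' : v ∈ U ∪ hi := by
      rw [← hZ] at hv
      simp only [mem_union] at hv ⊢
      tauto
    have hvP := hcov hv'
    simp only [hZ₂, mem_union, mem_inter] at hvP hv' ⊢
    tauto
  refine ⟨col₂, ?_, ?_, ?_⟩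
  · intro v hv
    rw [b1 v (fun h => hv (mem_inter.1 h).1), a1 v (fun h => hv (mem_sdiff.1 h).1)]
  · intro u hu
    by_cases huP : u ∈ P
    · exact b2 u (mem_inter.2 ⟨hu, huP⟩)
    · rw [b1 u (fun h => huP (mem_inter.1 h).2)]
      exact a2 u (mem_sdiff.2 ⟨hu, huP⟩)
  · intro u hu v hv huv
    by_cases huP : u ∈ P
    · exact key u (mem_inter.2 ⟨hu, huP⟩) v hv huv
    by_cases hvP : v ∈ U ∩ P
    · exact (key v hvP u (mem_union_left _ hu) huv.symm).symm
    rw [b1 u (fun h => huP (mem_inter.1 h).2), b1 v hvP]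
    refine a3 u (mem_sdiff.2 ⟨hu, huP⟩) v ?_ huv
    simp only [mem_union, mem_sdiff, mem_inter] at hv hvP ⊢
    tauto

/-- The extension statement behind the connectivity theorem: it strengthens colourability so that
it can be proved by induction on the uncoloured set. -/
theorem IsLightBoundary.coloringExtends {m k : ℕ} (hk : 1 ≤ k) {Y : Finset V}
    (hY : ∀ H ⊆ Y, NoSeparation G k H → ColorableOn G H m) (n : ℕ) :
    ∀ (U Z : Finset V) (col : V → ℕ), #U ≤ n → U ∪ Z ⊆ Y → IsLightBoundary G k U Z →
      ColoringExtends G (m + 16 * k) U Z col := by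
  induction n with
  | zero =>
    intro U Z col hU _ _
    obtain rfl : U = ∅ := by simpa using hU
    exact ⟨col, by simp, by simp, by simp⟩
  | succ n ihn =>
    intro U Z col hU hUZ h
    have hdeg : ∀ u ∈ U, degIn G Z u ≤ 9 * k := by
      intro u hu
      have := h.degIn_le u hu
      by_contra! hlt
      nlinarith
    -- a vertex with many neighbours of low degree is coloured greedily; this lowers the weight and
    -- so preserves the bound on the number of precoloured neighbours
    by_cases hex : ∃ u ∈ U, 4 * k ≤ degIn G (lowPart G k U Z) u
    · obtain ⟨u, hu, hlow⟩ := hex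
      have hne : (range (m + 16 * k) \ {z ∈ Z | G.Adj u z}.image col).Nonempty := by
        rw [← card_pos]
        have h1 := le_card_sdiff ({z ∈ Z | G.Adj u z}.image col) (range (m + 16 * k))
        have h2 : #({z ∈ Z | G.Adj u z}.image col) ≤ degIn G Z u := card_image_le
        have h3 := hdeg u hu
        rw [card_range] at h1
        omega
      obtain ⟨a, ha⟩ := hne
      simp only [mem_sdiff, mem_range, mem_image, mem_filter, not_exists, not_and, and_imp] at ha
      refine ColoringExtends.of_erase hu ha.1 (fun z hz huz => ha.2 z hz huz) ?_
      refine ihn _ _ _ ?_ ?_ (h.erase_insert hk hu hlow)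
      · rw [card_erase_of_mem hu]; omega
      · refine subset_trans ?_ hUZ
        intro x hx
        simp only [mem_union, mem_erase, mem_insert] at hx ⊢
        rcases hx with hx | rfl | hx
        · exact Or.inl hx.2
        · exact Or.inl hu
        · exact Or.inr hx
    push Not at hex
    have hW := boundaryWeight_eq (G := G) k U Z
    have hWle := h.weight_le
    set lo := lowPart G k U Z with hlo
    set hi := highPart G k U Z with hhi
    have hZ : lo ∪ hi = Z := lowPart_union_highPart _ _ _
    have hhiZ : hi ⊆ Z := highPart_subset _ _ _
    have hhi2 : #hi ≤ 2 * k := by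
      by_contra! hlt
      have h1 : 2 * k * #hi ≤ 4 * k ^ 2 := by omega
      nlinarith
    have hHU : U ∪ hi ⊆ U ∪ Z := union_subset_union_right hhiZ
    -- separations of `U ∪ hi` have uncoloured vertices on both sides, as each vertex of `hi` has too
    -- many neighbours in `U` to be cut off from all of them
    by_cases hsep : NoSeparation G k (U ∪ hi)
    · have hcol := (hY _ (hHU.trans hUZ) hsep).mono subset_union_left le_rfl
      rw [← hZ] at hdeg ⊢
      refine coloringExtends_of_colorableOn hk hcol hhi2 ?_ hdeg
      rw [sum_degIn_comm]
      omega
    · unfold NoSeparation at hsep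
      push Not at hsep
      obtain ⟨P, K₀, hPH, hPK, hK, hP, hQ, hadj⟩ := hsep
      set Q := (U ∪ hi) \ (P ∪ K₀) with hQdef
      set K := K₀ ∩ (U ∪ hi) with hKdef
      have hcov : ∀ x ∈ U ∪ hi, x ∈ P ∨ x ∈ K ∨ x ∈ Q := by
        intro x hx
        simp only [hQdef, hKdef, mem_sdiff, mem_inter, mem_union] at hx ⊢
        tauto
      have hKk : #K ≤ k := (card_le_card inter_subset_left).trans hK
      have hKU : K ⊆ U ∪ Z := inter_subset_right.trans hHU
      have hPQ : Disjoint P Q := disjoint_left.2 fun x hx hxQ => by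
        simp only [hQdef, mem_sdiff, mem_union] at hxQ
        tauto
      have hPK' : Disjoint P K := disjoint_of_subset_right inter_subset_left hPK
      have hQK' : Disjoint Q K := disjoint_left.2 fun x hx hxK => by
        simp only [hQdef, hKdef, mem_sdiff, mem_union, mem_inter] at hx hxK
        tauto
      have hQH : Q ⊆ U ∪ hi := sdiff_subset
      -- a high vertex on one side has more than `k` neighbours in `U`, so one on the same side
      have hside : ∀ A B : Finset V, A ⊆ U ∪ hi → A.Nonempty →
          (∀ x ∈ U ∪ hi, x ∈ A ∨ x ∈ K ∨ x ∈ B) → (∀ a ∈ A, ∀ b ∈ B, ¬ G.Adj a b) →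
          (U ∩ A).Nonempty := by
        intro A B hA hne hAB hno
        obtain ⟨z, hz⟩ := hne
        rcases mem_union.1 (hA hz) with hzU | hzh
        · exact ⟨z, mem_inter.2 ⟨hzU, hz⟩⟩
        · have hdz : ¬ degIn G U z < 2 * k := (mem_filter.1 hzh).2
          have : ¬ {x ∈ U | G.Adj z x} ⊆ K := fun hs => by
            have := card_le_card hs
            unfold degIn at hdz
            omega
          obtain ⟨x, hx, hxK⟩ := not_subset.1 this
          rw [mem_filter] at hx
          rcases hAB x (mem_union_left _ hx.1) with h1 | h1 | h1
          · exact ⟨x, mem_inter.2 ⟨hx.1, h1⟩⟩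
          · exact absurd h1 hxK
          · exact absurd hx.2 (hno z hz x h1)
      have hUP := hside P Q hPH hP hcov hadj
      have hUQ := hside Q P hQH hQ (fun x hx => by have := hcov x hx; tauto)
        (fun a ha b hb hab => hadj b hb a ha hab.symm)
      have ih : ∀ U' Z' col', #U' < #U → U' ⊆ U → Z' ⊆ U ∪ Z → IsLightBoundary G k U' Z' →
          ColoringExtends G (m + 16 * k) U' Z' col' := fun U' Z' col' h1 h2 h3 h4 =>
        ihn U' Z' col' (by omega)
          ((union_subset (h2.trans subset_union_left) h3).trans hUZ) h4
      have hsum : (2 * k * #(hi ∩ P) + ∑ z ∈ lo, degIn G (U ∩ P) z) +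
          (2 * k * #(hi ∩ Q) + ∑ z ∈ lo, degIn G (U ∩ Q) z) ≤ 4 * k ^ 2 := by
        have d1 : #(hi ∩ P) + #(hi ∩ Q) ≤ #hi := by
          rw [← card_union_of_disjoint (disjoint_of_subset_left inter_subset_right
            (disjoint_of_subset_right inter_subset_right hPQ))]
          exact card_le_card (union_subset inter_subset_left inter_subset_left)
        have d2 : ∑ z ∈ lo, degIn G (U ∩ P) z + ∑ z ∈ lo, degIn G (U ∩ Q) z ≤
            ∑ z ∈ lo, degIn G U z := by
          rw [← sum_add_distrib]
          refine sum_le_sum fun z _ => ?_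
          unfold degIn
          rw [← card_union_of_disjoint]
          · refine card_le_card fun x hx => ?_
            simp only [mem_union, mem_filter, mem_inter] at hx ⊢
            tauto
          · rw [disjoint_left]
            intro x hx hx'
            simp only [mem_filter, mem_inter] at hx hx'
            exact disjoint_left.1 hPQ hx.1.2 hx'.1.2
        nlinarith
      rcases Nat.lt_or_ge (2 * k ^ 2)
        (2 * k * #(hi ∩ P) + ∑ z ∈ lo, degIn G (U ∩ P) z) with hw | hw
      · refine coloringExtends_of_separation (P := Q) (K := K) (Q := P) h hex ?_ hKU hKk
          hQK' hPQ.symm (fun a ha b hb hab => hadj b hb a ha hab.symm) hUQ hUP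
          (by rw [← hlo, ← hhi]; omega) ih
        intro x hx
        have := hcov x hx
        simp only [mem_union]
        tauto
      · refine coloringExtends_of_separation (P := P) (K := K) (Q := Q) h hex ?_ hKU hKk
          hPK' hPQ hadj hUP hUQ hw ih
        intro x hx
        have := hcov x hx
        simp only [mem_union]
        tauto

/-- Subgraphs of large chromatic number contain highly connected subgraphs whose chromatic number
is smaller only by a linear function of the connectivity. -/
theorem exists_noSeparation_of_not_colorableOn {m k : ℕ} (hk : 1 ≤ k) {Y : Finset V}
    (hY : ¬ ColorableOn G Y (m + 16 * k)) :
    ∃ H ⊆ Y, NoSeparation G k H ∧ ¬ ColorableOn G H m := by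
  by_contra! hcon
  have hlight : IsLightBoundary G k Y ∅ :=
    ⟨by simp, by simp [boundaryWeight], by simp [boundaryWeight, degIn]⟩
  obtain ⟨col, -, h1, h2⟩ := hlight.coloringExtends hk hcon #Y Y ∅ 0 le_rfl (by simp)
  exact hY ⟨col, h1, fun x hx y hy => h2 x hx y (by simp [hy])⟩

end

/-! ### Locally tame sets and growing paths -/

section

open scoped Classical

variable {V : Type*} {G : SimpleGraph V}

/-- Inside `Y`, every set of `r` vertices contains a stable set of size `s`, and the common
neighbourhood of each stable set of size `s` is `c * r`-colourable. -/
structure IsLocallyTame (G : SimpleGraph V) (Y : Finset V) (s r c : ℕ) : Prop where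
  one_le : 1 ≤ r
  exists_indep : ∀ A ⊆ Y, r ≤ #A → ∃ S ⊆ A, #S = s ∧ G.IsIndepSet S
  common : ∀ S ⊆ Y, #S = s → G.IsIndepSet (S : Set V) →
    ColorableOn G {x ∈ Y | ∀ v ∈ S, G.Adj v x} (c * r)

/-- Few vertices are adjacent to almost all, in the sense of chromatic number, of a set `X` of
large chromatic number. -/
theorem IsLocallyTame.card_bad_lt {Y X : Finset V} {s r c M : ℕ} (h : IsLocallyTame G Y s r c)
    (hX : X ⊆ Y) (hcol : ¬ ColorableOn G X ((c + s * M) * r)) :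
    #{u ∈ Y | ColorableOn G {x ∈ X | ¬ G.Adj u x} (M * r)} < r := by
  by_contra! hr
  obtain ⟨S, hS, hSs, hind⟩ := h.exists_indep _ (filter_subset _ _) hr
  have h1 := h.common S (hS.trans (filter_subset _ _)) hSs hind
  have h2 := ColorableOn.biUnion (G := G) (t := fun u => {x ∈ X | ¬ G.Adj u x}) S
    (fun u hu => (mem_filter.1 (hS hu)).2)
  refine hcol ((h1.union h2).mono ?_ ?_)
  · intro x hx
    simp only [mem_union, mem_filter, mem_biUnion]
    by_cases hall : ∀ v ∈ S, G.Adj v x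
    · exact Or.inl ⟨hX hx, hall⟩
    · push Not at hall
      obtain ⟨v, hv, hvx⟩ := hall
      exact Or.inr ⟨v, hv, hx, hvx⟩
  · rw [hSs]
    exact le_of_eq (by ring)

/-- In units of `r`, a size that guarantees a stable set of a given cardinality. -/
def indepBound (s c : ℕ) : ℕ → ℕ
  | 0 => 0
  | L + 1 => c * L + s * (indepBound s c L + 1) + 1

/-- Large sets contain stable sets of any given size `L`. Either many vertices are common neighbours
of a stable set of size `s`, and a colouring of these has a large colour class, or some vertex has
many nonneighbours, and induction on `L` applies to them. -/
theorem IsLocallyTame.exists_indep_of_le_card {Y : Finset V} {s r c : ℕ}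
    (h : IsLocallyTame G Y s r c) (L : ℕ) :
    ∀ A ⊆ Y, indepBound s c L * r ≤ #A → ∃ S ⊆ A, #S = L ∧ G.IsIndepSet (S : Set V) := by
  have hr := h.one_le
  induction L with
  | zero => exact fun A _ _ => ⟨∅, by simp, by simp, by simp⟩
  | succ L ih =>
    intro A hA hcard
    rw [indepBound] at hcard
    obtain ⟨S, hSA, hSs, hind⟩ := h.exists_indep A hA
      ((Nat.le_mul_of_pos_left r (Nat.succ_pos _)).trans hcard)
    by_cases hbig : c * r * L < #{x ∈ A | ∀ v ∈ S, G.Adj v x}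
    · obtain ⟨f, hf1, hf2⟩ := (h.common S (hSA.trans hA) hSs hind).mono
        (filter_subset_filter _ hA) le_rfl
      obtain ⟨i, -, hi⟩ := exists_lt_card_fiber_of_mul_lt_card_of_maps_to (t := range (c * r))
        (f := f) (fun x hx => mem_range.2 (hf1 x hx)) (by rwa [card_range])
      obtain ⟨S', hS', hS'c⟩ := exists_subset_card_eq (Nat.succ_le_of_lt hi)
      refine ⟨S', fun x hx => ?_, hS'c, ?_⟩
      · have := hS' hx
        simp only [mem_filter] at this
        exact this.1.1
      · intro x hx y hy _ hadj
        have hx' := mem_filter.1 (hS' hx)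
        have hy' := mem_filter.1 (hS' hy)
        exact hf2 x hx'.1 y hy'.1 hadj (hx'.2.trans hy'.2.symm)
    · have hex : ∃ v ∈ S, (indepBound s c L + 1) * r ≤ #{x ∈ A | ¬ G.Adj v x} := by
        by_contra! hcon
        have h1 : A ⊆ {x ∈ A | ∀ v ∈ S, G.Adj v x} ∪ S.biUnion fun v => {x ∈ A | ¬ G.Adj v x} := by
          intro x hx
          simp only [mem_union, mem_filter, mem_biUnion]
          by_cases hall : ∀ v ∈ S, G.Adj v x
          · exact Or.inl ⟨hx, hall⟩
          · push Not at hall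
            obtain ⟨v, hv, hvx⟩ := hall
            exact Or.inr ⟨v, hv, hx, hvx⟩
        have h2 := (card_le_card h1).trans (card_union_le _ _)
        have h3 := card_biUnion_le_card_mul S (fun v => {x ∈ A | ¬ G.Adj v x}) _
          (fun v hv => (hcon v hv).le)
        rw [hSs] at h3
        nlinarith
      obtain ⟨v, hv, hcv⟩ := hex
      obtain ⟨S', hS', hS'c, hind'⟩ := ih ({x ∈ A | ¬ G.Adj v x}.erase v)
        ((erase_subset _ _).trans ((filter_subset _ _).trans hA)) (by
          rw [card_erase_of_mem (by simp [hSA hv])]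
          rw [add_mul, one_mul] at hcv
          omega)
      have hvS' : v ∉ S' := fun hv' => by simpa using hS' hv'
      refine ⟨insert v S', ?_, by rw [card_insert_of_notMem hvS', hS'c], ?_⟩
      · refine insert_subset (hSA hv) fun x hx => ?_
        have := hS' hx
        simp only [mem_erase, mem_filter] at this
        exact this.2.1
      · rw [coe_insert, SimpleGraph.IsIndepSet]
        refine Set.Pairwise.insert hind' fun b hb _ => ?_
        have := hS' hb
        simp only [mem_erase, mem_filter] at this
        exact ⟨this.2.2, fun hbv => this.2.2 hbv.symm⟩

/-- A stable set of size `ℓ + s` has a subset of size `ℓ` that is anticomplete to a large part of a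
given set: a vertex with fewer than `ℓ` nonneighbours in the stable set has `s` neighbours there. -/
theorem IsLocallyTame.exists_subset_anticomplete {Y X S : Finset V} {s r c ℓ M : ℕ}
    (h : IsLocallyTame G Y s r c) (hX : X ⊆ Y) (hS : S ⊆ Y) (hSc : #S = ℓ + s)
    (hind : G.IsIndepSet (S : Set V)) (hcol : ¬ ColorableOn G X (2 ^ (ℓ + s) * (c + M) * r)) :
    ∃ S₁ ⊆ S, #S₁ = ℓ ∧ ¬ ColorableOn G {x ∈ X | ∀ v ∈ S₁, ¬ G.Adj v x} (M * r) := by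
  by_contra! hcon
  have key : ∀ S' ∈ S.powerset, ColorableOn G
      {x ∈ X | #S' = s ∧ (∀ v ∈ S', G.Adj v x) ∨ #S' = ℓ ∧ ∀ v ∈ S', ¬ G.Adj v x}
      (c * r + M * r) := by
    intro S' hS'
    rw [mem_powerset] at hS'
    rw [filter_or]
    refine ColorableOn.union ?_ ?_
    · by_cases hs : #S' = s
      · refine (h.common S' (hS'.trans hS) hs (hind.mono hS')).mono ?_ le_rfl
        intro x hx
        simp only [mem_filter] at hx ⊢
        exact ⟨hX hx.1, hx.2.2⟩
      · exact ⟨fun _ => 0, by simp [hs], by simp [hs]⟩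
    · by_cases hs : #S' = ℓ
      · refine (hcon S' hS' hs).mono ?_ le_rfl
        intro x hx
        simp only [mem_filter] at hx ⊢
        exact ⟨hx.1, hx.2.2⟩
      · exact ⟨fun _ => 0, by simp [hs], by simp [hs]⟩
  refine hcol ((ColorableOn.biUnion S.powerset key).mono ?_ ?_)
  · intro x hx
    have hsplit := card_filter_add_card_filter_not (s := S) (fun v => G.Adj v x)
    simp only [mem_biUnion, mem_powerset, mem_filter]
    by_cases hs : s ≤ #{v ∈ S | G.Adj v x}
    · obtain ⟨S', hS', hc⟩ := exists_subset_card_eq hs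
      exact ⟨S', hS'.trans (filter_subset _ _), hx,
        Or.inl ⟨hc, fun v hv => (mem_filter.1 (hS' hv)).2⟩⟩
    · obtain ⟨S', hS', hc⟩ := exists_subset_card_eq (s := {v ∈ S | ¬ G.Adj v x}) (n := ℓ) (by omega)
      exact ⟨S', hS'.trans (filter_subset _ _), hx,
        Or.inr ⟨hc, fun v hv => (mem_filter.1 (hS' hv)).2⟩⟩
  · rw [card_powerset, hSc]
    exact le_of_eq (by ring)

/-- `p 0, …, p (n - 1)` is an induced path of `G` inside `X`, disjoint from `H`, and only its first
vertex `p 0` may have neighbours in `H`. The values of `p` beyond `n - 1` are irrelevant. -/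
structure IsPathInto (G : SimpleGraph V) (X : Finset V) (n : ℕ) (p : ℕ → V) (H : Finset V) :
    Prop where
  adj_iff : ∀ i < n, ∀ j < n, (G.Adj (p i) (p j) ↔ i + 1 = j ∨ j + 1 = i)
  inj : ∀ i < n, ∀ j < n, p i = p j → i = j
  mem : ∀ i < n, p i ∈ X
  notMem : ∀ i < n, p i ∉ H
  anticomplete : ∀ i, i + 1 < n → ∀ x ∈ H, ¬ G.Adj (p (i + 1)) x

theorem IsPathInto.mono {X H H' : Finset V} {n n' : ℕ} {p : ℕ → V} (h : IsPathInto G X n p H)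
    (hn : n' ≤ n) (hH : H' ⊆ H) : IsPathInto G X n' p H' where
  adj_iff i hi j hj := h.adj_iff i (hi.trans_le hn) j (hj.trans_le hn)
  inj i hi j hj := h.inj i (hi.trans_le hn) j (hj.trans_le hn)
  mem i hi := h.mem i (hi.trans_le hn)
  notMem i hi hx := h.notMem i (hi.trans_le hn) (hH hx)
  anticomplete i hi x hx := h.anticomplete i (hi.trans_le hn) x (hH hx)

/-- The sequence `p` with `w` put in front. -/
def consSeq (w : V) (p : ℕ → V) : ℕ → V
  | 0 => w
  | i + 1 => p i

theorem IsPathInto.cons {X H H' : Finset V} {n : ℕ} {p : ℕ → V} {w : V}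
    (h : IsPathInto G X n p H) (hHX : H ⊆ X) (hw : w ∈ H) (hadj : G.Adj (p 0) w) (hH : H' ⊆ H)
    (hwH : w ∉ H') (hanti : ∀ x ∈ H', ¬ G.Adj (p 0) x) :
    IsPathInto G X (n + 1) (consSeq w p) H' := by
  have hwp : ∀ j < n, (G.Adj w (p j) ↔ j = 0) := by
    intro j hj
    cases j with
    | zero => simp [hadj.symm]
    | succ j => simpa [G.adj_comm w] using h.anticomplete j hj w hw
  constructor
  · rintro (_ | i) hi (_ | j) hj
    · simp [consSeq]
    · rw [consSeq, consSeq, hwp j (by omega)]; omega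
    · rw [consSeq, consSeq, G.adj_comm, hwp i (by omega)]; omega
    · rw [consSeq, consSeq, h.adj_iff i (by omega) j (by omega)]; omega
  · rintro (_ | i) hi (_ | j) hj he
    · rfl
    · exact absurd (show w = p j from he) (fun e => h.notMem j (by omega) (e ▸ hw))
    · exact absurd (show p i = w from he) (fun e => h.notMem i (by omega) (e ▸ hw))
    · rw [h.inj i (by omega) j (by omega) he]
  · rintro (_ | i) hi
    · exact hHX hw
    · exact h.mem i (by omega)
  · rintro (_ | i) hi
    · exact hwH
    · exact fun hx => h.notMem i (by omega) (hH hx)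
  · rintro (_ | i) hi x hx
    · exact hanti x hx
    · exact h.anticomplete i (by omega) x (hH hx)

/-- Gyárfás path argument: if `p 0` has a neighbour in the connected set `A` but none in the
connected subset `Z`, the path can be prolonged inside `A` until its first vertex has a neighbour
in `Z`. -/
theorem IsPathInto.exists_attached {X Z : Finset V} {n : ℕ} (hne : Z.Nonempty)
    (hZc : NoSeparation G 0 Z) (A : Finset V) :
    ∀ p : ℕ → V, IsPathInto G X n p A → A ⊆ X → NoSeparation G 0 A →
      (∃ a ∈ A, G.Adj (p 0) a) → Z ⊆ A → (∀ z ∈ Z, ¬ G.Adj (p 0) z) →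
      ∃ p' : ℕ → V, p' 0 ∈ A \ Z ∧ IsPathInto G X (n + 1) p' Z ∧ ∃ z ∈ Z, G.Adj (p' 0) z := by
  induction A using Finset.strongInduction with
  | H A ih =>
    intro p hp hAX hAc hnbr hZA hZp
    -- a maximal connected set of nonneighbours of `p 0` around `Z` is joined to the rest of `A` only
    -- through neighbours of `p 0`
    obtain ⟨C, hC, hmax⟩ := exists_max_image
      {C ∈ A.powerset | Z ⊆ C ∧ NoSeparation G 0 C ∧ ∀ z ∈ C, ¬ G.Adj (p 0) z} card
      ⟨Z, by simp only [mem_filter, mem_powerset]; exact ⟨hZA, subset_rfl, hZc, hZp⟩⟩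
    simp only [mem_filter, mem_powerset] at hC hmax
    obtain ⟨hCA, hZC, hCc, hCp⟩ := hC
    obtain ⟨a, haA, ha⟩ := hnbr
    obtain ⟨x, hxC, w, hw, hxw⟩ := hAc C ∅ hCA (by simp) (by simp) (hne.mono hZC)
      ⟨a, by simpa [haA] using fun haC => hCp a haC ha⟩
    simp only [union_empty, mem_sdiff] at hw
    have hpw : G.Adj (p 0) w := by
      by_contra hpw
      have := hmax (insert w C) ⟨insert_subset hw.1 hCA, hZC.trans (subset_insert _ _),
        hCc.insert hxC hxw, fun z hz => by
          rcases mem_insert.1 hz with rfl | hz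
          · exact hpw
          · exact hCp z hz⟩
      rw [card_insert_of_notMem hw.2] at this
      omega
    by_cases hwZ : ∃ z ∈ Z, G.Adj w z
    · exact ⟨consSeq w p, by simp only [mem_sdiff]; exact ⟨hw.1, fun h => hw.2 (hZC h)⟩,
        hp.cons hAX hw.1 hpw hZA (fun h => hw.2 (hZC h)) hZp, hwZ⟩
    · push Not at hwZ
      obtain ⟨p', h1, h2, h3⟩ := ih C ⟨hCA, fun h => hw.2 (h hw.1)⟩ (consSeq w p)
        ((hp.cons hAX hw.1 hpw hCA hw.2 hCp).mono (Nat.le_succ n) le_rfl) (hCA.trans hAX) hCc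
        ⟨x, hxC, hxw.symm⟩ hZC hwZ
      exact ⟨p', sdiff_subset_sdiff hCA subset_rfl h1, h2, h3⟩

/-- An induced path of `n` vertices whose first vertex has many neighbours in a highly connected
set `H`, the other path vertices having none, while the nonneighbours of the first vertex in `H`
still have large chromatic number. -/
structure IsGrowingPath (G : SimpleGraph V) (X : Finset V) (r K M n : ℕ) (p : ℕ → V)
    (H : Finset V) : Prop where
  path : IsPathInto G X n p H
  subset : H ⊆ X
  noSeparation : NoSeparation G (K * r) H
  le_degIn : K * r ≤ degIn G H (p 0)
  not_colorableOn : ¬ ColorableOn G {x ∈ H | ¬ G.Adj (p 0) x} (M * r)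

theorem IsLocallyTame.exists_isGrowingPath_one {Y X : Finset V} {s r c K M : ℕ}
    (h : IsLocallyTame G Y s r c) (hX : X ⊆ Y)
    (hcol : ¬ ColorableOn G X ((c + s * (M + 1) + (K + 3) + 16 * (K + 1)) * r)) :
    ∃ p H, IsGrowingPath G X r K M 1 p H := by
  have hr := h.one_le
  obtain ⟨H, hHX, hH, hHcol⟩ := exists_noSeparation_of_not_colorableOn (G := G) (Y := X)
    (k := (K + 1) * r) (m := (c + s * (M + 1) + (K + 3)) * r) (by nlinarith)
    (by rwa [← mul_assoc, ← add_mul])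
  have hB := h.card_bad_lt (M := M + 1) (hHX.trans hX)
    (fun hc => hHcol (hc.mono subset_rfl (Nat.mul_le_mul_right _ (by omega))))
  set B := {u ∈ Y | ColorableOn G {x ∈ H | ¬ G.Adj u x} ((M + 1) * r)} with hBdef
  obtain ⟨v, hv, hvB⟩ : ∃ v ∈ H, v ∉ B := by
    by_contra! hcon
    exact hHcol ((colorableOn_card H).mono subset_rfl ((card_le_card hcon).trans
      (hB.le.trans (Nat.le_mul_of_pos_left r (by omega)))))
  have hle : (K + 1) * r + 1 ≤ (c + s * (M + 1) + (K + 3)) * r :=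
    le_trans (by nlinarith) (Nat.mul_le_mul_right r (show K + 2 ≤ _ by omega))
  have hdeg := hH.lt_degree (fun hc => hHcol (hc.mono subset_rfl hle)) hv
  refine ⟨fun _ => v, H.erase v, ⟨?_, ?_, ?_, ?_, ?_⟩, (erase_subset _ _).trans hHX, ?_, ?_, ?_⟩
  · intro i hi j hj
    simp only [SimpleGraph.irrefl, false_iff]
    omega
  · intro i hi j hj _
    omega
  · exact fun _ _ => hHX hv
  · simp
  · intro i hi
    omega
  · rw [← sdiff_singleton_eq_erase]
    exact hH.sdiff (b := 1) (by simp) (by nlinarith)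
  · have e : {x ∈ H.erase v | G.Adj v x} = {x ∈ H | G.Adj v x} := by
      ext x
      simp only [mem_filter, mem_erase]
      exact ⟨fun h => ⟨h.1.2, h.2⟩, fun h => ⟨⟨h.2.ne', h.1⟩, h.2⟩⟩
    rw [degIn, e]
    nlinarith
  · intro hc
    refine hvB ?_
    simp only [hBdef, mem_filter]
    refine ⟨hX (hHX hv), (hc.union (colorableOn_card {v})).mono ?_ ?_⟩
    · intro x hx
      simp only [mem_filter, mem_union, mem_erase, mem_singleton] at hx ⊢
      tauto
    · rw [card_singleton]
      nlinarith

/-- A growing path can be prolonged, at the cost of a constant factor in the chromatic number. The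
subset `H₀` is found with connectivity `(2 * K + 1) * r`, because up to `r` vertices (those adjacent
to almost all of `H₀`) and up to `K * r` vertices (the neighbours of the new path vertex) may have to
be deleted from it. -/
theorem IsGrowingPath.exists_succ {Y X H : Finset V} {s r c K M n : ℕ} {p : ℕ → V}
    (h : IsLocallyTame G Y s r c) (hX : X ⊆ Y)
    (hp : IsGrowingPath G X r 1 (c + s * (M + 1 + K) + (2 * K + 2) + 16 * (2 * K + 1)) n p H) :
    ∃ p' H', IsGrowingPath G X r K M (n + 1) p' H' := by
  have hr := h.one_le
  obtain ⟨H₀, hH₀, hsep, hcol⟩ := exists_noSeparation_of_not_colorableOn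
    (G := G) (Y := {x ∈ H | ¬ G.Adj (p 0) x}) (k := (2 * K + 1) * r)
    (m := (c + s * (M + 1 + K) + (2 * K + 2)) * r) (by nlinarith)
    (by rw [← mul_assoc, ← add_mul]; exact hp.not_colorableOn)
  have hH₀H : H₀ ⊆ H := hH₀.trans (filter_subset _ _)
  have hH₀Y : H₀ ⊆ Y := hH₀H.trans (hp.subset.trans hX)
  have hB := h.card_bad_lt (M := M + 1 + K) hH₀Y
    (fun hc => hcol (hc.mono subset_rfl (Nat.mul_le_mul_right _ (by omega))))
  set B := {u ∈ Y | ColorableOn G {x ∈ H₀ | ¬ G.Adj u x} ((M + 1 + K) * r)} with hBdef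
  have hBcol : ∀ {T : Finset V} {a : ℕ}, ColorableOn G (T \ B) a → ColorableOn G T (a + r) := by
    intro T a hT
    refine (hT.union (colorableOn_card B)).mono (fun x hx => ?_) (by omega)
    simp only [mem_union, mem_sdiff]
    tauto
  set Z := H₀ \ B with hZ
  have hZH : Z ⊆ H \ B := sdiff_subset_sdiff hH₀H subset_rfl
  have hZsep : NoSeparation G (2 * K * r) Z := hsep.sdiff hB.le (by nlinarith)
  have hZcol : ¬ ColorableOn G Z (2 * K * r + 1) := fun hc =>
    hcol ((hBcol hc).mono subset_rfl (le_trans (by nlinarith)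
      (Nat.mul_le_mul_right r (show 2 * K + 2 ≤ _ by omega))))
  have hZne : Z.Nonempty := by
    by_contra hne
    rw [not_nonempty_iff_eq_empty] at hne
    exact hZcol ((colorableOn_card Z).mono subset_rfl (by simp [hne]))
  have hsubX : H \ B ⊆ X := sdiff_subset.trans hp.subset
  obtain ⟨p', h0, hpath, z, hz, hpz⟩ := IsPathInto.exists_attached hZne
    (hZsep.mono (Nat.zero_le _)) (H \ B) p (hp.path.mono le_rfl sdiff_subset) hsubX
    (hp.noSeparation.sdiff hB.le (by omega))
    (by
      by_contra! hcon
      have hsub : {x ∈ H | G.Adj (p 0) x} ⊆ B := by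
        intro x hx
        rw [mem_filter] at hx
        by_contra hxB
        exact hcon x (mem_sdiff.2 ⟨hx.1, hxB⟩) hx.2
      have h1 := card_le_card hsub
      have h2 := hp.le_degIn
      unfold degIn at h2
      omega)
    hZH (fun z hz => (mem_filter.1 (hH₀ (sdiff_subset hz))).2)
  have hgood : ∀ u ∈ X \ B, ¬ ColorableOn G {x ∈ H₀ | ¬ G.Adj u x} ((M + 1 + K) * r) := by
    intro u hu hc
    rw [mem_sdiff] at hu
    exact hu.2 (mem_filter.2 ⟨hX hu.1, hc⟩)
  have h0' : p' 0 ∈ X \ B := by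
    simp only [mem_sdiff] at h0 ⊢
    exact ⟨hp.subset h0.1.1, h0.1.2⟩
  have hZX : Z ⊆ X := hZH.trans hsubX
  by_cases hdeg : K * r ≤ degIn G Z (p' 0)
  · refine ⟨p', Z, hpath, hZX, hZsep.mono (by nlinarith), hdeg, fun hc => hgood _ h0' ?_⟩
    refine (hBcol (hc.mono ?_ le_rfl)).mono subset_rfl (by nlinarith)
    intro x hx
    simp only [hZ, mem_sdiff, mem_filter] at hx ⊢
    tauto
  -- few neighbours: step onto one of them and delete the others
  · push Not at hdeg
    set N := {x ∈ Z | G.Adj (p' 0) x} with hN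
    have hNc : #N < K * r := hdeg
    have hzB : z ∈ X \ B := by
      have := hZH hz
      simp only [mem_sdiff] at this ⊢
      exact ⟨hp.subset this.1, this.2⟩
    have hzN : z ∈ N := mem_filter.2 ⟨hz, hpz⟩
    refine ⟨consSeq z p', Z \ N, ?_, sdiff_subset.trans hZX, hZsep.sdiff hNc.le (by nlinarith),
      ?_, fun hc => hgood z hzB ?_⟩
    · refine (hpath.cons hZX hz hpz sdiff_subset (by simp [hzN]) ?_).mono (Nat.le_succ _) subset_rfl
      intro x hx hadj
      rw [mem_sdiff] at hx
      exact hx.2 (mem_filter.2 ⟨hx.1, hadj⟩)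
    · have h1 := hZsep.lt_degree hZcol hz
      have h2 := degIn_mono (G := G) (show Z ⊆ (Z \ N) ∪ N by
        intro x hx; simp only [mem_union, mem_sdiff]; tauto) z
      have h3 := degIn_union_le (G := G) (Z \ N) N z
      have h4 := degIn_le_card (G := G) N z
      change _ ≤ degIn G (Z \ N) z
      have h5 : 2 * K * r < degIn G Z z := h1
      nlinarith
    · change ColorableOn G {x ∈ Z \ N | ¬ G.Adj z x} (M * r) at hc
      refine (hBcol ((hc.union (colorableOn_card N)).mono ?_ le_rfl)).mono subset_rfl (by nlinarith)
      intro x hx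
      simp only [hZ, mem_sdiff, mem_filter, mem_union] at hx ⊢
      tauto

end

/-! ### Brooms, forests of brooms and Ramsey numbers -/

section

open scoped Classical

theorem exists_isGrowingPath (s c n : ℕ) :
    ∀ K M : ℕ, ∃ M₀ : ℕ, ∀ {V : Type u} {G : SimpleGraph V} {Y X : Finset V} {r : ℕ},
      IsLocallyTame G Y s r c → X ⊆ Y → ¬ ColorableOn G X (M₀ * r) →
        ∃ p H, IsGrowingPath G X r K M (n + 1) p H := by
  induction n with
  | zero => exact fun K M => ⟨_, fun h hX hcol => h.exists_isGrowingPath_one hX hcol⟩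
  | succ n ih =>
    intro K M
    obtain ⟨M₀, hM₀⟩ := ih 1 (c + s * (M + 1 + K) + (2 * K + 2) + 16 * (2 * K + 1))
    refine ⟨M₀, fun h hX hcol => ?_⟩
    obtain ⟨p, H, hp⟩ := hM₀ h hX hcol
    exact hp.exists_succ h hX

/-- A set of large chromatic number contains an induced broom anticomplete to a subset whose
chromatic number is still large: the bristles are found in the neighbourhood of the first vertex of
a growing path. -/
theorem exists_broom_anticomplete (s c : ℕ) {k : ℕ} (hk : 1 ≤ k) (ℓ M : ℕ) :
    ∃ C : ℕ, ∀ {V : Type u} {G : SimpleGraph V} {Y X : Finset V} {r : ℕ},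
      IsLocallyTame G Y s r c → X ⊆ Y → ¬ ColorableOn G X (C * r) →
        ∃ φ : broom k ℓ ↪g G, (∀ a, φ a ∈ X) ∧ ∃ X' ⊆ X, ¬ ColorableOn G X' (M * r) ∧
          ∀ a, ∀ x ∈ X', φ a ≠ x ∧ ¬ G.Adj (φ a) x := by
  obtain ⟨n, rfl⟩ : ∃ n, k = n + 1 := ⟨k - 1, by omega⟩
  obtain ⟨C, hC⟩ := exists_isGrowingPath.{u} s c n (indepBound s c (ℓ + s))
    (2 ^ (ℓ + s) * (c + M))
  refine ⟨C, fun {V G Y X r} h hX hcol => ?_⟩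
  obtain ⟨p, H, hp⟩ := hC h hX hcol
  have hHX := hp.subset
  obtain ⟨S, hSN, hSc, hind⟩ := h.exists_indep_of_le_card (ℓ + s) {x ∈ H | G.Adj (p 0) x}
    ((filter_subset _ _).trans (hHX.trans hX)) hp.le_degIn
  have hSH : ∀ x ∈ S, x ∈ H ∧ G.Adj (p 0) x := fun x hx => mem_filter.1 (hSN hx)
  obtain ⟨S₁, hS₁, hS₁c, hcol'⟩ := h.exists_subset_anticomplete
    (X := {x ∈ H | ¬ G.Adj (p 0) x}) ((filter_subset _ _).trans (hHX.trans hX))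
    (fun x hx => hX (hHX (hSH x hx).1)) hSc hind hp.not_colorableOn
  let e := S₁.equivFinOfCardEq hS₁c
  have heS : ∀ j, ((e.symm j : S₁) : V) ∈ S := fun j => hS₁ (e.symm j).2
  have hpe : ∀ i < n + 1, ∀ j, G.Adj (p i) (e.symm j) ↔ i = 0 := by
    rintro (_ | i) hi j
    · simp [(hSH _ (heS j)).2]
    · simpa using hp.path.anticomplete i hi _ (hSH _ (heS j)).1
  have hne : ∀ i < n + 1, ∀ j, p i ≠ (e.symm j : S₁) := fun i hi j hij =>
    hp.path.notMem i hi (hij ▸ (hSH _ (heS j)).1)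
  refine ⟨⟨⟨Sum.elim (fun i => p i) (fun j => (e.symm j : S₁)), ?_⟩, ?_⟩, ?_,
    {x ∈ {x ∈ H | ¬ G.Adj (p 0) x} | ∀ v ∈ S₁, ¬ G.Adj v x},
    (filter_subset _ _).trans ((filter_subset _ _).trans hHX), hcol', ?_⟩
  · rintro (i | i) (j | j) hij
    · exact congrArg _ (Fin.ext (hp.path.inj i i.2 j j.2 hij))
    · exact absurd hij (hne i i.2 j)
    · exact absurd hij.symm (hne j j.2 i)
    · exact congrArg _ (e.symm.injective (Subtype.ext hij))
  · rintro (i | i) (j | j)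
    · exact hp.path.adj_iff i i.2 j j.2
    · exact hpe i i.2 j
    · exact (G.adj_comm _ _).trans (hpe j j.2 i)
    · refine iff_of_false (fun hadj => ?_) id
      exact hind (heS i) (heS j) hadj.ne hadj
  · rintro (i | j)
    · exact hp.path.mem i i.2
    · exact hHX (hSH _ (heS j)).1
  · intro a x hx
    simp only [mem_filter] at hx
    rcases a with ⟨_ | i, hi⟩ | j
    · exact ⟨fun hpx => absurd (show p 0 = x from hpx)
        fun h0 => hp.path.notMem 0 hi (h0 ▸ hx.1.1), hx.1.2⟩
    · exact ⟨fun hpx => absurd (show p (i + 1) = x from hpx)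
        fun h0 => hp.path.notMem (i + 1) hi (h0 ▸ hx.1.1), hp.path.anticomplete i hi x hx.1.1⟩
    · exact ⟨fun hex => hx.1.2 (hex ▸ (hSH _ (heS j)).2), hx.2 _ (e.symm j).2⟩

/-- Any finite set of components of a forest of brooms embeds in every set of large chromatic
number: each broom leaves an anticomplete set in which to find the others. -/
theorem exists_components_embedding (s c : ℕ) {W : Type v} (T : SimpleGraph W)
    (hT : ∀ D : T.ConnectedComponent, IsBroom D.toSimpleGraph)
    (𝒞 : Finset T.ConnectedComponent) :
    ∃ C : ℕ, ∀ {V : Type u} {G : SimpleGraph V} {Y X : Finset V} {r : ℕ},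
      IsLocallyTame G Y s r c → X ⊆ Y → ¬ ColorableOn G X (C * r) →
        ∃ φ : W → V, (∀ w, T.connectedComponentMk w ∈ 𝒞 → φ w ∈ X) ∧
          ∀ w w', T.connectedComponentMk w ∈ 𝒞 → T.connectedComponentMk w' ∈ 𝒞 →
            (φ w = φ w' → w = w') ∧ (G.Adj (φ w) (φ w') ↔ T.Adj w w') := by
  induction 𝒞 using Finset.induction_on with
  | empty =>
    refine ⟨0, fun {V G Y X r} _ _ hcol => ?_⟩
    have hne : X.Nonempty := by
      by_contra hne
      rw [not_nonempty_iff_eq_empty] at hne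
      exact hcol ((colorableOn_card X).mono subset_rfl (by simp [hne]))
    exact ⟨fun _ => hne.choose, by simp, by simp⟩
  | insert D 𝒞 hD ih =>
    obtain ⟨C₀, hC₀⟩ := ih
    obtain ⟨k, ℓ, hk, -, ⟨e⟩⟩ := hT D
    obtain ⟨C, hC⟩ := exists_broom_anticomplete.{u} s c (by omega : 1 ≤ k) ℓ C₀
    refine ⟨C, fun {V G Y X r} h hX hcol => ?_⟩
    obtain ⟨ψ, hψX, X', hX', hcol', hanti⟩ := hC h hX hcol
    obtain ⟨φ, hφX, hφ⟩ := hC₀ h (hX'.trans hX) hcol'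
    let θ : ∀ w, T.connectedComponentMk w = D → V := fun w hw => ψ (e ⟨w, hw⟩)
    have hθ : ∀ w hw, ∀ w', T.connectedComponentMk w' ∈ 𝒞 →
        θ w hw ≠ φ w' ∧ ¬ G.Adj (θ w hw) (φ w') := fun w hw w' hw' =>
      hanti _ _ (hφX w' hw')
    have hcomp : ∀ w w', T.connectedComponentMk w = D → T.connectedComponentMk w' ∈ 𝒞 →
        ¬ T.Adj w w' := fun w w' hw hw' hadj => by
      refine hD ?_
      rwa [← hw, SimpleGraph.ConnectedComponent.connectedComponentMk_eq_of_adj hadj]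
    have hin : ∀ w, T.connectedComponentMk w ∈ insert D 𝒞 → T.connectedComponentMk w ≠ D →
        T.connectedComponentMk w ∈ 𝒞 := fun w hw hwD => by
      rcases mem_insert.1 hw with h | h
      · exact absurd h hwD
      · exact h
    refine ⟨fun w => if hw : T.connectedComponentMk w = D then θ w hw else φ w, ?_, ?_⟩
    · intro w hw
      by_cases hwD : T.connectedComponentMk w = D
      · simp only [hwD, dif_pos]
        exact hψX _
      · simp only [hwD, dif_neg, not_false_eq_true]
        exact hX' (hφX w (hin w hw hwD))
    · intro w w' hw hw'
      by_cases hwD : T.connectedComponentMk w = D <;>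
        by_cases hwD' : T.connectedComponentMk w' = D <;>
        simp only [hwD, hwD', dif_pos, dif_neg, not_false_eq_true]
      · refine ⟨fun heq => ?_, ?_⟩
        · exact congrArg Subtype.val (e.injective (ψ.injective heq))
        · rw [SimpleGraph.Embedding.map_adj_iff, SimpleGraph.Iso.map_adj_iff]
          rfl
      · have h1 := hθ w hwD w' (hin w' hw' hwD')
        exact ⟨fun heq => absurd heq h1.1, iff_of_false h1.2 (hcomp w w' hwD (hin w' hw' hwD'))⟩
      · have h1 := hθ w' hwD' w (hin w hw hwD)
        exact ⟨fun heq => absurd heq.symm h1.1, iff_of_false (fun h => h1.2 h.symm)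
          (fun h => hcomp w' w hwD' (hin w hw hwD) h.symm)⟩
      · exact hφ w w' (hin w hw hwD) (hin w' hw' hwD')

/-- `Y` contains an induced complete multipartite graph with `m` parts of size `s`. -/
def HasMultipartite {V : Type*} (G : SimpleGraph V) (m s : ℕ) (Y : Finset V) : Prop :=
  ∃ φ : Fin m × Fin s → V, Function.Injective φ ∧ (∀ a, φ a ∈ Y) ∧
    ∀ a b, G.Adj (φ a) (φ b) ↔ a.1 ≠ b.1

theorem HasMultipartite.succ {V : Type*} {G : SimpleGraph V} {m s : ℕ} {Y S : Finset V}
    (hS : S ⊆ Y) (hSs : #S = s) (hind : G.IsIndepSet (S : Set V))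
    (h : HasMultipartite G m s {x ∈ Y | ∀ v ∈ S, G.Adj v x}) : HasMultipartite G (m + 1) s Y := by
  obtain ⟨φ, hφ, hφY, hadj⟩ := h
  simp only [mem_filter] at hφY
  let e := S.equivFinOfCardEq hSs
  have hcross : ∀ j a, G.Adj (e.symm j : S) (φ a) := fun j a => (hφY a).2 _ (e.symm j).2
  refine ⟨fun a => Fin.cases (motive := fun _ => V) ((e.symm a.2 : S) : V) (fun i => φ (i, a.2)) a.1,
    ?_, ?_, ?_⟩
  · rintro ⟨i, j⟩ ⟨i', j'⟩ hij
    refine Fin.cases ?_ (fun i => ?_) i hij <;> refine Fin.cases ?_ (fun i' => ?_) i'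
    · intro h
      have h' : ((e.symm j : S) : V) = (e.symm j' : S) := h
      rw [e.symm.injective (Subtype.ext h')]
    · intro h
      exact absurd h (hcross j (i', j')).ne
    · intro h
      exact absurd h (hcross j' (i, j)).ne'
    · intro h
      have := hφ (show φ (i, j) = φ (i', j') from h)
      simpa using this
  · rintro ⟨i, j⟩
    refine Fin.cases ?_ (fun i => ?_) i
    · exact hS (e.symm j).2
    · exact (hφY (i, j)).1
  · rintro ⟨i, j⟩ ⟨i', j'⟩
    refine Fin.cases ?_ (fun i => ?_) i <;> refine Fin.cases ?_ (fun i' => ?_) i'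
    · refine iff_of_false (fun h => ?_) (fun h => h rfl)
      exact hind (e.symm j).2 (e.symm j').2 h.ne h
    · exact iff_of_true (hcross j (i', j')) (Fin.succ_ne_zero i').symm
    · exact iff_of_true (hcross j' (i, j)).symm (Fin.succ_ne_zero i)
    · exact (hadj (i, j) (i', j')).trans (Fin.succ_injective m).ne_iff.symm

/-- The theorem with the Ramsey number replaced by any `r` for which every set of `r` vertices
contains a stable set of size `s`; this hypothesis, unlike one on the clique number, is used
without change in the induction on the number `m` of parts. -/
theorem exists_colorableOn_of_free (s : ℕ) {W : Type v} [Finite W] (T : SimpleGraph W)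
    (hT : ∀ D : T.ConnectedComponent, IsBroom D.toSimpleGraph) (m : ℕ) :
    ∃ c : ℕ, ∀ {V : Type u} {G : SimpleGraph V} {Y : Finset V} {r : ℕ}, 1 ≤ r →
      (∀ A ⊆ Y, r ≤ #A → ∃ S ⊆ A, #S = s ∧ G.IsIndepSet (S : Set V)) → IsInducedFree T G →
        ¬ HasMultipartite G m s Y → ColorableOn G Y (c * r) := by
  induction m with
  | zero =>
    refine ⟨0, fun _ _ _ hm => absurd ⟨fun a => a.1.elim0, ?_, fun a => a.1.elim0,
      fun a => a.1.elim0⟩ hm⟩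
    exact fun a => a.1.elim0
  | succ m ih =>
    obtain ⟨c, hc⟩ := ih
    have : Fintype T.ConnectedComponent := Fintype.ofFinite _
    obtain ⟨C, hC⟩ := exists_components_embedding.{u} s c T hT univ
    refine ⟨C, fun {V G Y r} hr hind hfree hmult => ?_⟩
    by_contra hcol
    have htame : IsLocallyTame G Y s r c := ⟨hr, hind, fun S hSY hSs hS =>
      hc hr (fun A hA => hind A (hA.trans (filter_subset _ _))) hfree
        (fun h => hmult (h.succ hSY hSs hS))⟩
    obtain ⟨φ, -, hφ⟩ := hC htame subset_rfl hcol
    exact hfree ⟨⟨⟨φ, fun w w' hw => (hφ w w' (mem_univ _) (mem_univ _)).1 hw⟩,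
      fun {w w'} => (hφ w w' (mem_univ _) (mem_univ _)).2⟩⟩

/-- The finite Ramsey theorem. -/
theorem exists_ramsey_bound (s w : ℕ) : ∃ n : ℕ, ∀ {V : Type u} (G : SimpleGraph V)
    (A : Finset V), n ≤ #A →
      (∃ S ⊆ A, G.IsNIndepSet s S) ∨ ∃ S ⊆ A, G.IsNClique w S := by
  induction s generalizing w with
  | zero => exact ⟨0, fun G A _ => Or.inl ⟨∅, by simp, by simp [SimpleGraph.isNIndepSet_iff]⟩⟩
  | succ s ihs =>
    induction w with
    | zero => exact ⟨0, fun G A _ => Or.inr ⟨∅, by simp, by simp [SimpleGraph.isNClique_iff]⟩⟩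
    | succ w ihw =>
      obtain ⟨n₁, h₁⟩ := ihs (w + 1)
      obtain ⟨n₂, h₂⟩ := ihw
      refine ⟨n₁ + n₂ + 1, fun {V} G A hA => ?_⟩
      obtain ⟨v, hv⟩ : A.Nonempty := card_pos.1 (by omega)
      have hsplit := card_filter_add_card_filter_not (s := A.erase v) (fun x => G.Adj v x)
      rw [card_erase_of_mem hv] at hsplit
      have hsub : ∀ (q : V → Prop) [DecidablePred q], {x ∈ A.erase v | q x} ⊆ A := fun q _ =>
        (filter_subset _ _).trans (erase_subset _ _)
      by_cases hcase : n₂ ≤ #{x ∈ A.erase v | G.Adj v x}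
      · rcases h₂ G _ hcase with ⟨S, hS, hSi⟩ | ⟨S, hS, hSc⟩
        · exact Or.inl ⟨S, hS.trans (hsub _), hSi⟩
        · exact Or.inr ⟨insert v S, insert_subset hv (hS.trans (hsub _)),
            hSc.insert fun b hb => (mem_filter.1 (hS hb)).2⟩
      · rcases h₁ G {x ∈ A.erase v | ¬ G.Adj v x} (by omega) with ⟨S, hS, hSi⟩ | ⟨S, hS, hSc⟩
        · refine Or.inl ⟨insert v S, insert_subset hv (hS.trans (hsub _)), ?_, ?_⟩
          · rw [coe_insert, SimpleGraph.IsIndepSet]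
            refine Set.Pairwise.insert hSi.1 fun b hb _ => ?_
            have := (mem_filter.1 (hS hb)).2
            exact ⟨this, fun h => this h.symm⟩
          · rw [card_insert_of_notMem fun h => by simpa using hS h, hSi.2]
        · exact Or.inr ⟨S, hS.trans (hsub _), hSc⟩

theorem ramseyNumber_spec (s w : ℕ) : 1 ≤ ramseyNumber s w ∧
    ∀ G : SimpleGraph (Fin (ramseyNumber s w)),
      (∃ A : Finset (Fin (ramseyNumber s w)), G.IsNIndepSet s A) ∨
        (∃ A : Finset (Fin (ramseyNumber s w)), G.IsNClique w A) := by
  obtain ⟨n, hn⟩ := exists_ramsey_bound.{0} s w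
  refine Nat.sInf_mem (s := {n : ℕ | 1 ≤ n ∧ ∀ G : SimpleGraph (Fin n),
    (∃ A : Finset (Fin n), G.IsNIndepSet s A) ∨ (∃ A : Finset (Fin n), G.IsNClique w A)})
    ⟨n + 1, by omega, fun G => ?_⟩
  rcases hn G univ (by simp) with ⟨S, -, hS⟩ | ⟨S, -, hS⟩
  · exact Or.inl ⟨S, hS⟩
  · exact Or.inr ⟨S, hS⟩

theorem exists_indep_of_ramseyNumber_le {V : Type*} [Finite V] (G : SimpleGraph V) (s : ℕ)
    (A : Finset V) (hA : ramseyNumber s (G.cliqueNum + 1) ≤ #A) :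
    ∃ S ⊆ A, #S = s ∧ G.IsIndepSet (S : Set V) := by
  obtain ⟨A', hA', hc⟩ := exists_subset_card_eq hA
  let f : Fin (ramseyNumber s (G.cliqueNum + 1)) ↪ V :=
    (A'.equivFinOfCardEq hc).symm.toEmbedding.trans (Function.Embedding.subtype _)
  have hf : ∀ i, f i ∈ A := fun i => hA' ((A'.equivFinOfCardEq hc).symm i).2
  rcases (ramseyNumber_spec s (G.cliqueNum + 1)).2 (G.comap f) with ⟨S, hS⟩ | ⟨S, hS⟩
  · refine ⟨S.map f, fun x hx => ?_, by rw [card_map, hS.2], ?_⟩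
    · obtain ⟨i, -, rfl⟩ := mem_map.1 hx
      exact hf i
    · rw [coe_map]
      rintro _ ⟨i, hi, rfl⟩ _ ⟨j, hj, rfl⟩ hij
      exact hS.1 hi hj (fun h => hij (h ▸ rfl))
  · have hcl : G.IsClique (S.map f : Finset V) := by
      rw [coe_map]
      rintro _ ⟨i, hi, rfl⟩ _ ⟨j, hj, rfl⟩ hij
      exact hS.1 hi hj (fun h => hij (h ▸ rfl))
    have := hcl.card_le_cliqueNum
    rw [card_map, hS.2] at this
    omega

end

theorem mainTheorem7 (m s : ℕ) (hm : 1 ≤ m) (hs : 2 ≤ s)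
    {W : Type v} [Finite W] (T : SimpleGraph W) (hT : T.IsAcyclic)
    (hbroom : ∀ c : T.ConnectedComponent, IsBroom c.toSimpleGraph) :
    ∃ C : ℕ, 1 ≤ C ∧ ∀ (V : Type u) [Finite V] (G : SimpleGraph V),
      IsInducedFree T G → IsInducedFree (disjointCliques m s)ᶜ G →
        G.chromaticNumber ≤ ((C * ramseyNumber s (G.cliqueNum + 1) : ℕ) : ℕ∞) := by
  obtain ⟨c, hc⟩ := exists_colorableOn_of_free.{u} s T hbroom m
  refine ⟨c + 1, by omega, fun V _ G hfree hmult => ?_⟩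
  have := Fintype.ofFinite V
  have hcol : ColorableOn G univ (c * ramseyNumber s (G.cliqueNum + 1)) := by
    refine hc (ramseyNumber_spec s _).1
      (fun A _ hA => exists_indep_of_ramseyNumber_le G s A hA) hfree ?_
    rintro ⟨φ, hφ, -, hadj⟩
    refine hmult ⟨⟨⟨φ, hφ⟩, fun {a b} => (hadj a b).trans ?_⟩⟩
    rw [SimpleGraph.compl_adj]
    simp only [disjointCliques, ne_eq, Prod.ext_iff]
    tauto
  obtain ⟨f, hf, hproper⟩ := hcol.mono subset_rfl
    (Nat.mul_le_mul_right _ (Nat.le_succ c))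
  exact SimpleGraph.Colorable.chromaticNumber_le ⟨SimpleGraph.Coloring.mk
    (fun x => ⟨f x, hf x (mem_univ x)⟩) fun {x y} hxy h =>
      hproper x (mem_univ x) y (mem_univ y) hxy (Fin.ext_iff.1 h)⟩
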